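/- Let $\mathcal C$ be a uniserial category, that is, an essentially small abelian category in which every object has a finite composition series and every indecomposable object has a unique composition series. Let $\mathcal A=\operatorname{Lex}(\mathcal C^{\mathrm{op}},\mathrm{Ab})$ be the category of left exact functors $\mathcal C^{\mathrm{op}}\to\mathrm{Ab}$ from $\mathcal C^{\mathrm{op}}$ to abelian groups, and regard $\mathcal C$ as a full subcategory of $\mathcal A$ via the Yoneda embedding $X\mapsto\operatorname{Hom}_{\mathcal C}(-,X)$. Then every nonzero object of $\mathcal A$ has an indecomposable direct summand that is isomorphic to an object of $\mathcal C$ or is an injective object of $\mathcal A$. -/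

import Mathlib

open CategoryTheory CategoryTheory.Limits Opposite

universe v u

namespace Uniserial

section LeftExact

variable {B : Type*} [Category* B] {D : Type*} [Category* D]

/-- A limit of left exact functors, computed in the functor category, is left exact. -/
instance leftExactFunctor_isClosedUnderLimitsOfShape (J : Type*) [Category* J]
    [HasLimitsOfShape J D] : (leftExactFunctor B D).IsClosedUnderLimitsOfShape J where
  limitsOfShape_le := by
    rintro X ⟨p⟩
    have hp : ∀ j, PreservesFiniteLimits (p.diag.obj j) := p.prop_diag_obj
    have h : PreservesFiniteLimits p.diag.flip :=
      preservesFiniteLimits_of_evaluation _ fun j => hp j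
    have h' : PreservesFiniteLimits (p.diag.flip ⋙ lim) :=
      comp_preservesFiniteLimits _ _
    exact preservesFiniteLimits_of_natIso ((limitIsoFlipCompLim p.diag).symm ≪≫
      (limit.isLimit p.diag).conePointUniqueUpToIso p.isLimit)

end LeftExact

/-- The category `Lex(Cᵒᵖ, Ab)` of left exact functors `Cᵒᵖ ⥤ Ab`. Between abelian categories, a
functor that preserves finite limits is automatically additive. -/
abbrev LexCat (C : Type u) [Category.{v} C] : Type (max u (v + 1)) :=
  LeftExactFunctor Cᵒᵖ AddCommGrpCat.{v}

/-- `Lex(Cᵒᵖ, Ab)` has binary direct sums (they are computed pointwise). -/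
instance lex_hasBinaryBiproducts (C : Type u) [Category.{v} C] : HasBinaryBiproducts (LexCat C) :=
  HasBinaryBiproducts.of_hasBinaryProducts

/-- The Yoneda embedding `C ⥤ Lex(Cᵒᵖ, Ab)`, `X ↦ Hom(-, X)`. -/
noncomputable def lexYoneda (C : Type u) [Category.{v} C] [Preadditive C] : C ⥤ LexCat C :=
  (leftExactFunctor Cᵒᵖ AddCommGrpCat.{v}).lift preadditiveYoneda fun X =>
    (inferInstance : PreservesFiniteLimits (preadditiveYoneda.obj X))

section Length

variable {C : Type u} [Category.{v} C] [Abelian C]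

/-- A composition series of `X`: a finite chain `0 = X₀ ⊂ X₁ ⊂ ⋯ ⊂ Xₙ = X` of subobjects of `X`
in which each `Xᵢ` is maximal among the proper subobjects of `Xᵢ₊₁`, that is, `Xᵢ₊₁ / Xᵢ` is
simple. -/
structure CompSeries (X : C) where
  series : RelSeries {(U, V) : Subobject X × Subobject X | U ⋖ V}
  head_eq : series.head = ⊥
  last_eq : series.last = ⊤

variable (C) in
/-- A length category: an abelian category that is essentially small and in which every object has
a finite composition series. -/
structure IsLengthCategory : Prop where
  essentiallySmall : EssentiallySmall.{v} C
  exists_compSeries : ∀ X : C, Nonempty (CompSeries X)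

variable (C) in
/-- A uniserial category: a length category in which every indecomposable object has a unique
composition series. -/
structure IsUniserialCategory : Prop extends IsLengthCategory C where
  unique_compSeries : ∀ X : C, Indecomposable X → Nonempty (Unique (CompSeries X))

end Length

/-- `Y` is a direct summand of `X`. -/
def IsDirectSummand {A : Type*} [Category* A] [HasZeroMorphisms A] [HasBinaryBiproducts A]
    (Y X : A) : Prop :=
  ∃ Z : A, Nonempty (X ≅ Y ⊞ Z)

end Uniserial

/-! Call a `Stage` over a nonzero element `f` of `X(S)`, with `S` simple, a uniserial `V` with socle
`S` and an element `g` of `X(V)` restricting to `f`. Two cases arise.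

If some `f` has a stage of maximal length, the morphism `Hom(-, V) ⟶ X` given by `g` splits
(`exists_retraction_of_maximal`). On elements `h^* x + p^* g`, where `h` is killed by every morphism
to `V`, the retraction is forced to be `p`; maximality makes this well defined, and Zorn's lemma
extends it to `X` (`exists_hom_of_isPartialHom`).

If instead every stage over every `f` can be lengthened, fix `f` and choose compatible stages `V₀ ⊂
V₁ ⊂ ⋯` of unbounded length. The union of the images of the `Hom(-, Vₙ)` in `X` is left exact,
injective by a Baer criterion (`injective_of_extension`), hence a summand, and indecomposable
because `f` is essential in it (`exists_injective_summand`).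

Both cases rest on `exists_extension_of_len_le`: of two uniserial objects with the same socle, the
shorter embeds in the longer over that socle. -/

namespace Uniserial

/-! ### Covering chains in modular lattices -/

section Lattice

open Relation

theorem reflTransGen_of_wcovBy {β : Type*} [PartialOrder β] {a b : β} (h : a ⩿ b) :
    ReflTransGen (· ⋖ ·) a b := by
  rcases h.covBy_or_eq with h | rfl
  · exact .single h
  · exact .refl

variable {α : Type*} [Lattice α] [IsModularLattice α]

theorem wcovBy_inf_of_covBy {a b : α} (w : α) (h : a ⋖ b) : w ⊓ a ⩿ w ⊓ b := by
  refine ⟨inf_le_inf_left _ h.le, fun c h1 h2 => ?_⟩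
  have hcw : c ≤ w := h2.le.trans inf_le_left
  have hcb : c ≤ b := h2.le.trans inf_le_right
  rcases h.eq_or_eq (le_sup_right : a ≤ c ⊔ a) (sup_le hcb h.le) with h3 | h3
  · exact h1.not_ge (le_inf hcw (sup_eq_right.1 h3))
  · have h4 := sup_inf_assoc_of_le (y := a) hcw
    rw [h3] at h4
    rw [inf_comm w b, h4, inf_comm a w, sup_eq_left.2 h1.le] at h2
    exact lt_irrefl _ h2

theorem wcovBy_sup_of_covBy {a b : α} (w : α) (h : a ⋖ b) : w ⊔ a ⩿ w ⊔ b :=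
  (wcovBy_inf_of_covBy (α := αᵒᵈ) (a := b) (b := a) w h.toDual).ofDual

theorem reflTransGen_inf {a b : α} (w : α) (h : ReflTransGen (· ⋖ ·) a b) :
    ReflTransGen (· ⋖ ·) (w ⊓ a) (w ⊓ b) := by
  induction h with
  | refl => exact .refl
  | tail _ h ih => exact ih.trans (reflTransGen_of_wcovBy (wcovBy_inf_of_covBy w h))

theorem reflTransGen_sup {a b : α} (w : α) (h : ReflTransGen (· ⋖ ·) a b) :
    ReflTransGen (· ⋖ ·) (w ⊔ a) (w ⊔ b) := by
  induction h with
  | refl => exact .refl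
  | tail _ h ih => exact ih.trans (reflTransGen_of_wcovBy (wcovBy_sup_of_covBy w h))

theorem exists_relSeries_of_reflTransGen {β : Type*} {r : SetRel β β} {a b : β}
    (h : ReflTransGen (fun x y => (x, y) ∈ r) a b) :
    ∃ s : RelSeries r, s.head = a ∧ s.last = b := by
  induction h with
  | refl => exact ⟨RelSeries.singleton r a, rfl, rfl⟩
  | tail _ h ih =>
    obtain ⟨s, h1, h2⟩ := ih
    exact ⟨s.snoc _ (h2 ▸ h), by simpa using h1, by simp⟩

theorem reflTransGen_of_relSeries {β : Type*} {r : SetRel β β} (s : RelSeries r) :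
    ReflTransGen (fun x y => (x, y) ∈ r) s.head s.last := by
  induction s using RelSeries.inductionOn' with
  | singleton x => exact .refl
  | snoc p x hx ih => simpa using ih.tail hx

/-- A finite covering chain from `⊥` to `b` gives a strictly monotone rank on the elements
below `b`. -/
theorem exists_rank_of_reflTransGen [OrderBot α] {b : α} (h : ReflTransGen (· ⋖ ·) ⊥ b) :
    ∃ ρ : α → ℕ, ∀ x y, x < y → y ≤ b → ρ x < ρ y := by
  classical
  induction h with
  | refl => exact ⟨fun _ => 0, fun x y h1 h2 => absurd (h1.trans_le h2) not_lt_bot⟩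
  | @tail a b _ hab ih =>
    obtain ⟨ρ, hρ⟩ := ih
    -- Passing from `a` to `b` adds one for elements not below `a`. If `x ⊓ a = y ⊓ a` and neither
    -- is below `a`, both joins with `a` equal `b`, so modularity excludes `x < y`.
    refine ⟨fun x => ρ (x ⊓ a) + if x ≤ a then 0 else 1, fun x y hxy hyb => ?_⟩
    have hmono : (if x ≤ a then 0 else 1) ≤ (if y ≤ a then 0 else 1 : ℕ) := by
      split_ifs with h1 h2 h2
      · exact le_rfl
      · exact zero_le_one
      · exact absurd (hxy.le.trans h2) h1
      · exact le_rfl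
    rcases (inf_le_inf_right a hxy.le).lt_or_eq with h | h
    · exact add_lt_add_of_lt_of_le (hρ _ _ h inf_le_right) hmono
    · dsimp only
      rw [h]
      have hya : ¬ y ≤ a := fun hya => hxy.ne (by
        rwa [inf_eq_left.2 hya, inf_eq_left.2 (hxy.le.trans hya)] at h)
      by_cases hxa : x ≤ a
      · simp [hxa, hya]
      · have key : ∀ z, z ≤ b → ¬ z ≤ a → z ⊔ a = b := fun z h1 h2 =>
          (hab.eq_or_eq le_sup_right (sup_le h1 hab.le)).resolve_left
            fun h3 => h2 (sup_eq_right.1 h3)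
        exact absurd (eq_of_le_of_inf_le_of_sup_le hxy.le h.ge
          ((key y hyb hya).trans (key x (hxy.le.trans hyb) hxa).symm).le) hxy.ne

end Lattice

/-! ### Modularity of subobject lattices -/

section Modular

variable {C : Type u} [Category.{v} C] [Abelian C]

theorem exists_fac_of_epi_mono {T' T R B : C} {e : T' ⟶ T} [Epi e] {m : R ⟶ B} [Mono m]
    {t : T ⟶ B} {f : T' ⟶ R} (h : e ≫ t = f ≫ m) : ∃ g : T ⟶ R, g ≫ m = t := by
  have : StrongEpi e := strongEpi_of_epi e
  have sq : CommSq f e m t := ⟨h.symm⟩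
  exact ⟨sq.lift, sq.fac_right⟩

theorem subobject_factors_of_epi {T' T B : C} (R : Subobject B) (e : T' ⟶ T) [Epi e] (t : T ⟶ B)
    (h : R.Factors (e ≫ t)) : R.Factors t := by
  obtain ⟨g, hg⟩ := exists_fac_of_epi_mono (R.factorThru_arrow _ h).symm
  exact hg ▸ Subobject.factors_comp_arrow g

/-- `X ⊞ Y` maps onto an image containing `X ⊔ Y`, so a generalized element of the join splits as a
sum after an epimorphic cover. This permits element-style proofs. -/
theorem exists_epi_of_sup_factors {T B : C} {X Y : Subobject B} {t : T ⟶ B}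
    (h : (X ⊔ Y).Factors t) :
    ∃ (T' : C) (e : T' ⟶ T) (p : T' ⟶ X) (q : T' ⟶ Y), Epi e ∧
      e ≫ t = p ≫ X.arrow + q ≫ Y.arrow := by
  let d : (X : C) ⊞ (Y : C) ⟶ B := biprod.desc X.arrow Y.arrow
  have hX : X ≤ Subobject.mk (image.ι d) := Subobject.le_mk_of_comm
    (biprod.inl ≫ factorThruImage d) (by simp [d])
  have hY : Y ≤ Subobject.mk (image.ι d) := Subobject.le_mk_of_comm
    (biprod.inr ≫ factorThruImage d) (by simp [d])
  obtain ⟨g, hg⟩ : ∃ g : T ⟶ image d, g ≫ image.ι d = t := (Subobject.mk_factors_iff _ _).1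
    (Subobject.factors_of_le t (sup_le hX hY) h)
  refine ⟨pullback g (factorThruImage d), pullback.fst _ _,
    pullback.snd _ _ ≫ biprod.fst, pullback.snd _ _ ≫ biprod.snd, inferInstance, ?_⟩
  rw [← hg, pullback.condition_assoc, image.fac, Category.assoc, Category.assoc,
    ← Preadditive.comp_add]
  congr 1
  apply biprod.hom_ext' <;> simp [d]

instance subobject_isModularLattice (B : C) : IsModularLattice (Subobject B) where
  sup_inf_le_assoc_of_le {X} Y Z hXZ := by
    refine Subobject.le_of_factors ?_
    obtain ⟨T', e, p, q, he, h⟩ := exists_epi_of_sup_factors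
      (Subobject.inf_arrow_factors_left (X ⊔ Y) Z)
    apply subobject_factors_of_epi _ e
    rw [h]
    apply Subobject.factors_add
    · exact Subobject.sup_factors_of_factors_left (Subobject.factors_comp_arrow _)
    · apply Subobject.sup_factors_of_factors_right
      rw [Subobject.inf_factors]
      refine ⟨Subobject.factors_comp_arrow _, ?_⟩
      apply Subobject.factors_right_of_factors_add (p ≫ X.arrow)
      · rw [← h]
        exact Subobject.factors_of_factors_right _ (Subobject.inf_arrow_factors_right _ _)
      · exact Subobject.factors_of_le _ hXZ (Subobject.factors_comp_arrow _)

end Modular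

/-! ### Length and induction on it -/

section LengthFunction

variable {C : Type u} [Category.{v} C] [Abelian C]

theorem pullback_factors_iff {T X Y : C} (f : X ⟶ Y) (P : Subobject Y) (h : T ⟶ X) :
    ((Subobject.pullback f).obj P).Factors h ↔ P.Factors (h ≫ f) := by
  have hp := Subobject.isPullback f P
  constructor
  · intro H
    have := (((Subobject.pullback f).obj P).factorThru h H) ≫= hp.w
    rw [Subobject.factorThru_arrow_assoc] at this
    exact this ▸ Subobject.factors_of_factors_right _ (Subobject.factors_comp_arrow _)
  · intro H
    have := hp.lift_snd (P.factorThru _ H) h (by simp)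
    exact this ▸ Subobject.factors_comp_arrow _

/-- The length of an object, as the least top value of a strictly monotone rank function on its
subobjects. -/
noncomputable def len (X : C) : ℕ :=
  sInf {n | ∃ ρ : Subobject X → ℕ, StrictMono ρ ∧ ρ ⊤ = n}

omit [Abelian C] in
theorem len_le_of_strictMono {X : C} {ρ : Subobject X → ℕ} (hρ : StrictMono ρ) : len X ≤ ρ ⊤ :=
  Nat.sInf_le ⟨ρ, hρ, rfl⟩

theorem CompSeries.reflTransGen {X : C} (s : CompSeries X) :
    Relation.ReflTransGen (· ⋖ ·) (⊥ : Subobject X) ⊤ := by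
  have := reflTransGen_of_relSeries s.series
  rwa [s.head_eq, s.last_eq] at this

theorem exists_strictMono_eq_len {X : C} (hX : Nonempty (CompSeries X)) :
    ∃ ρ : Subobject X → ℕ, StrictMono ρ ∧ ρ ⊤ = len X := by
  obtain ⟨s⟩ := hX
  obtain ⟨ρ, hρ⟩ := exists_rank_of_reflTransGen s.reflTransGen
  exact Nat.sInf_mem (s := {n | ∃ ρ : Subobject X → ℕ, StrictMono ρ ∧ ρ ⊤ = n})
    ⟨ρ ⊤, ρ, fun x y h => hρ x y h le_top, rfl⟩

theorem len_lt_of_mono {A B : C} (hB : Nonempty (CompSeries B)) (i : A ⟶ B) [Mono i]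
    (hi : ¬ IsIso i) : len A < len B := by
  obtain ⟨ρ, hρ, h⟩ := exists_strictMono_eq_len hB
  rw [← h]
  have hm : StrictMono (Subobject.map i).obj :=
    (Subobject.map i).monotone.strictMono_of_injective (Subobject.map_obj_injective i)
  refine (len_le_of_strictMono (hρ.comp hm)).trans_lt (hρ ?_)
  rw [Subobject.map_top]
  exact lt_top_iff_ne_top.2 fun h => hi ((Subobject.isIso_iff_mk_eq_top i).2 h)

theorem len_lt_of_epi {A B : C} (hA : Nonempty (CompSeries A)) (e : A ⟶ B) [Epi e]
    (he : ¬ IsIso e) : len B < len A := by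
  obtain ⟨ρ, hρ, h⟩ := exists_strictMono_eq_len hA
  have hm : StrictMono (Subobject.pullback e).obj := by
    refine (Subobject.pullback e).monotone.strictMono_of_injective fun P Q hPQ => ?_
    have key : ∀ P Q : Subobject B, (Subobject.pullback e).obj P ≤ (Subobject.pullback e).obj Q →
        P ≤ Q := by
      intro P Q h
      have : Epi (Subobject.pullbackπ e P) := Abelian.epi_fst_of_isLimit _ _
        (Subobject.isPullback e P).isLimit
      refine Subobject.le_of_factors (subobject_factors_of_epi Q (Subobject.pullbackπ e P) _ ?_)
      rw [(Subobject.isPullback e P).w, ← pullback_factors_iff]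
      exact Subobject.factors_of_le _ h (Subobject.factors_self _)
    exact le_antisymm (key _ _ hPQ.le) (key _ _ hPQ.ge)
  have hk : ρ ⊥ < ρ ((Subobject.pullback e).obj ⊥) := by
    refine hρ (bot_lt_iff_ne_bot.2 fun h0 => he ?_)
    have : Mono e := Preadditive.mono_of_cancel_zero _ fun {G} g hg => by
      rw [← Subobject.bot_factors_iff_zero, ← h0, pullback_factors_iff, hg]
      exact Subobject.factors_zero
    exact isIso_of_mono_of_epi e
  have hle : ∀ P, ρ ((Subobject.pullback e).obj ⊥) ≤ ρ ((Subobject.pullback e).obj P) :=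
    fun P => hρ.monotone ((Subobject.pullback e).monotone bot_le)
  -- Rank on `B`: pull back along `e` and subtract the rank of the kernel, which is positive as `e`
  -- is not mono; `hle` keeps the subtraction from truncating.
  have := len_le_of_strictMono
    (ρ := fun P => ρ ((Subobject.pullback e).obj P) - ρ ((Subobject.pullback e).obj ⊥))
    fun P Q hPQ => by
      have := hρ (hm hPQ)
      have := hle P
      dsimp only
      omega
  rw [Subobject.pullback_top] at this
  have := hle ⊤
  rw [Subobject.pullback_top] at this
  omega

variable (hL : ∀ X : C, Nonempty (CompSeries X))
include hL

theorem len_le_of_mono {A B : C} (i : A ⟶ B) [Mono i] : len A ≤ len B := by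
  obtain ⟨ρ, hρ, h⟩ := exists_strictMono_eq_len (hL B)
  rw [← h]
  have hm : StrictMono (Subobject.map i).obj :=
    (Subobject.map i).monotone.strictMono_of_injective (Subobject.map_obj_injective i)
  exact (len_le_of_strictMono (hρ.comp hm)).trans (hρ.monotone le_top)

theorem isIso_of_mono_of_len_le {A B : C} (i : A ⟶ B) [Mono i] (h : len B ≤ len A) : IsIso i := by
  by_contra hi
  exact (len_lt_of_mono (hL B) i hi).not_ge h

theorem isZero_or_indecomposable_induction {P : C → Prop}
    (zero : ∀ B, IsZero B → P B) (indec : ∀ B, Indecomposable B → P B)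
    (sum : ∀ A B D, (D ≅ A ⊞ B) → P A → P B → P D) (B : C) : P B := by
  induction h : len B using Nat.strong_induction_on generalizing B with
  | _ n ih =>
  subst h
  by_cases h0 : IsZero B
  · exact zero B h0
  by_cases h1 : Indecomposable B
  · exact indec B h1
  have : ∃ Y Z, ∃ _ : B ≅ Y ⊞ Z, ¬ IsZero Y ∧ ¬ IsZero Z := by
    by_contra! h
    exact h1 ⟨h0, fun Y Z i => or_iff_not_imp_left.2 fun hY => h Y Z i hY⟩
  obtain ⟨Y, Z, i, hY, hZ⟩ := this
  refine sum Y Z B i (ih _ ?_ _ rfl) (ih _ ?_ _ rfl)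
  · refine len_lt_of_mono (hL B) (biprod.inl ≫ i.inv) fun h => ?_
    have := IsIso.of_isIso_comp_right biprod.inl i.inv
    exact hZ ((Biprod.isIso_inl_iff_isZero Y Z).1 this)
  · refine len_lt_of_mono (hL B) (biprod.inr ≫ i.inv) fun h => ?_
    have := IsIso.of_isIso_comp_right biprod.inr i.inv
    refine hY ((Biprod.isIso_inl_iff_isZero Z Y).1 ?_)
    have : (biprod.inl : Z ⟶ Z ⊞ Y) = biprod.inr ≫ (biprod.braiding Y Z).hom := by
      apply biprod.hom_ext <;> simp
    rw [this]
    infer_instance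

theorem exists_simple_mono (B : C) (hB : ¬ IsZero B) :
    ∃ (S : C) (s : S ⟶ B), Simple S ∧ Mono s := by
  induction h : len B using Nat.strong_induction_on generalizing B with
  | _ n ih =>
  subst h
  by_cases h1 : Simple B
  · exact ⟨B, 𝟙 B, h1, inferInstance⟩
  have : ∃ (A : C) (i : A ⟶ B), Mono i ∧ ¬ IsIso i ∧ i ≠ 0 := by
    by_contra! h
    refine h1 ⟨fun {A} f hf => ⟨fun hf' h0 => hB ?_, fun h0 => ?_⟩⟩
    · subst h0
      exact (IsZero.iff_id_eq_zero B).2 (by rw [← IsIso.inv_hom_id (0 : A ⟶ B), comp_zero])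
    · by_contra hf'
      exact h0 (h A f hf hf')
  obtain ⟨A, i, hi, hi', hi0⟩ := this
  obtain ⟨S, s, hS, hs⟩ := ih _ (len_lt_of_mono (hL B) i hi') A
    (fun h => hi0 (h.eq_zero_of_src i)) rfl
  exact ⟨S, s ≫ i, hS, mono_comp _ _⟩

end LengthFunction

/-! ### Objects whose subobjects form a chain -/

section UniserialObject

variable {C : Type u} [Category.{v} C]

/-- An object whose subobjects form a chain. -/
def IsUniserial (U : C) : Prop :=
  ∀ ⦃A B : C⦄ (a : A ⟶ U) (b : B ⟶ U) [Mono a] [Mono b], (∃ c, c ≫ b = a) ∨ ∃ c, c ≫ a = b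

variable [Abelian C]

theorem IsUniserial.of_epi {U V : C} (hU : IsUniserial U) (e : U ⟶ V) [Epi e] :
    IsUniserial V := by
  have key : ∀ ⦃A B : C⦄ (a : A ⟶ V) (b : B ⟶ V) [Mono a] [Mono b],
      (∃ c, c ≫ pullback.snd b e = pullback.snd a e) → ∃ c, c ≫ b = a := by
    rintro A B a b _ _ ⟨c, hc⟩
    refine exists_fac_of_epi_mono (e := pullback.fst a e) (f := c ≫ pullback.fst b e) ?_
    rw [pullback.condition, ← hc, Category.assoc, Category.assoc, pullback.condition]
  intro A B a b _ _
  exact (hU (pullback.snd a e) (pullback.snd b e)).imp (key a b) (key b a)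

/-- Meeting and joining a composition series with any subobject `W` yields covering chains from `⊥`
to `W` and from `W` to `⊤`. So `W` lies on a composition series, which by uniqueness is the given
one. -/
theorem isUniserial_of_unique_compSeries {U : C} (h : Nonempty (Unique (CompSeries U))) :
    IsUniserial U := by
  obtain ⟨h⟩ := h
  let s : CompSeries U := default
  have hs : StrictMono s.series.toFun := Fin.strictMono_iff_lt_succ.2 fun i => (s.series.step i).lt
  have key : ∀ W : Subobject U, ∃ i, s.series i = W := by
    intro W
    have hg := s.reflTransGen
    have h1 := reflTransGen_inf W hg
    have h2 := reflTransGen_sup W hg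
    rw [inf_bot_eq, inf_top_eq] at h1
    rw [sup_bot_eq, sup_top_eq] at h2
    obtain ⟨p, hp, hp'⟩ := exists_relSeries_of_reflTransGen
      (r := {(U, V) : Subobject U × Subobject U | U ⋖ V}) h1
    obtain ⟨q, hq, hq'⟩ := exists_relSeries_of_reflTransGen
      (r := {(U, V) : Subobject U × Subobject U | U ⋖ V}) h2
    have hs : s = ⟨p.smash q (hp'.trans hq.symm), by simpa using hp, by simpa using hq'⟩ :=
      Subsingleton.elim _ _
    rw [hs]
    exact ⟨_, (RelSeries.smash_castLE (hp'.trans hq.symm) (Fin.last _)).trans hp'⟩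
  intro A B a b _ _
  obtain ⟨i, hi⟩ := key (Subobject.mk a)
  obtain ⟨j, hj⟩ := key (Subobject.mk b)
  rcases le_total i j with hij | hij
  · have := hs.monotone hij
    exact .inl ⟨Subobject.ofMkLEMk a b (hi ▸ hj ▸ this), Subobject.ofMkLEMk_comp _⟩
  · have := hs.monotone hij
    exact .inr ⟨Subobject.ofMkLEMk b a (hi ▸ hj ▸ this), Subobject.ofMkLEMk_comp _⟩

/-- The kernel of `h` is comparable with `S`: it cannot contain `S`, so it lies properly inside the
simple `S` and vanishes. -/
theorem IsUniserial.mono_of_comp_ne_zero {U S Y : C} [Simple S] (hU : IsUniserial U) (a : S ⟶ U)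
    [Mono a] (h : U ⟶ Y) (hne : a ≫ h ≠ 0) : Mono h := by
  rcases hU a (kernel.ι h) with ⟨c, hc⟩ | ⟨c, hc⟩
  · exact absurd (by rw [← hc, Category.assoc, kernel.condition, comp_zero]) hne
  · have : Mono c := by
      have : Mono (c ≫ a) := hc ▸ inferInstance
      exact mono_of_mono c a
    by_cases h0 : c = 0
    · exact Preadditive.mono_of_kernel_zero (by rw [← hc, h0, zero_comp])
    · have := (Simple.mono_isIso_iff_nonzero c).2 h0
      refine absurd ?_ hne
      rw [← cancel_epi c, comp_zero, ← Category.assoc, hc, kernel.condition]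

theorem IsUniserial.exists_fac_of_mono {U S A : C} [Simple S] (hU : IsUniserial U) (a : S ⟶ U)
    [Mono a] (i : A ⟶ U) [Mono i] (hA : ¬ IsZero A) : ∃ c, c ≫ i = a := by
  refine (hU a i).elim id ?_
  rintro ⟨c, hc⟩
  have : Mono c := by
    have : Mono (c ≫ a) := hc ▸ inferInstance
    exact mono_of_mono c a
  have : IsIso c := (Simple.mono_isIso_iff_nonzero c).2 fun h0 =>
    hA (IsZero.of_mono_eq_zero c h0)
  exact ⟨inv c, by simp [← hc]⟩

end UniserialObject

/-! ### Comparing uniserial objects with a common socle -/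

section Comparison

variable {C : Type u} [Category.{v} C] [Abelian C]
  (hL : ∀ X : C, Nonempty (CompSeries X)) (hI : ∀ X : C, Indecomposable X → IsUniserial X)

include hL in
theorem exists_indecomposable_comp_ne_zero {S : C} (B : C) (c : S ⟶ B) (hc : c ≠ 0) :
    ∃ (P : C) (p : B ⟶ P), Indecomposable P ∧ c ≫ p ≠ 0 := by
  induction B using isZero_or_indecomposable_induction hL with
  | zero B hB => exact absurd (hB.eq_zero_of_tgt c) hc
  | indec B hB => exact ⟨B, 𝟙 B, hB, by simpa⟩
  | sum A B D i hA hB =>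
    by_cases h1 : c ≫ i.hom ≫ biprod.fst = 0
    · by_cases h2 : c ≫ i.hom ≫ biprod.snd = 0
      · refine absurd ?_ hc
        rw [← cancel_mono i.hom, zero_comp]
        apply biprod.hom_ext <;> simp [h1, h2]
      · obtain ⟨P, p, hP, hp⟩ := hB _ h2
        exact ⟨P, (i.hom ≫ biprod.snd) ≫ p, hP, by simpa using hp⟩
    · obtain ⟨P, p, hP, hp⟩ := hA _ h1
      exact ⟨P, (i.hom ≫ biprod.fst) ≫ p, hP, by simpa using hp⟩

include hL hI

/-- Uniserial objects with the same socle embed into one another, according to length. -/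
theorem exists_extension_of_len_le {S U V : C} [Simple S] (hU : IsUniserial U)
    (hV : IsUniserial V) (a : S ⟶ U) (b : S ⟶ V) [Mono a] [Mono b] (h : len U ≤ len V) :
    ∃ c : U ⟶ V, a ≫ c = b := by
  have hne : a ≫ pushout.inl a b ≠ 0 := fun h0 => Simple.not_isZero S
    (IsZero.of_mono_eq_zero _ h0)
  -- An indecomposable `P` under the pushout that detects `S` receives both `U` and `V` as
  -- subobjects, and these are comparable there.
  obtain ⟨P, p, hP, hp⟩ := exists_indecomposable_comp_ne_zero hL _ _ hne
  have hp' : b ≫ pushout.inr a b ≫ p ≠ 0 := by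
    rwa [← pushout.condition_assoc, ← Category.assoc]
  rw [Category.assoc] at hp
  have h1 := hU.mono_of_comp_ne_zero a _ hp
  have h2 := hV.mono_of_comp_ne_zero b _ hp'
  rcases hI P hP (pushout.inl a b ≫ p) (pushout.inr a b ≫ p) with ⟨c, hc⟩ | ⟨c, hc⟩
  · refine ⟨c, ?_⟩
    rw [← cancel_mono (pushout.inr a b ≫ p), Category.assoc, hc, pushout.condition_assoc]
  · have hcm : Mono c := by
      have : Mono (c ≫ pushout.inl a b ≫ p) := hc ▸ inferInstance
      exact mono_of_mono c (pushout.inl a b ≫ p)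
    have := isIso_of_mono_of_len_le hL c h
    have hb : b ≫ c = a := by
      rw [← cancel_mono (pushout.inl a b ≫ p), Category.assoc, hc, pushout.condition_assoc]
    exact ⟨inv c, by simp [← hb]⟩

/-- A morphism `d` from a simple object extends to a uniserial object `U` if every indecomposable
quotient that detects `d` is at least as long as `U`. -/
theorem exists_extension_of_forall_len_le {S U : C} [Simple S] (hU : IsUniserial U) (a : S ⟶ U)
    [Mono a] (D : C) (d : S ⟶ D)
    (h : ∀ (P : C) (q : D ⟶ P), Indecomposable P → d ≫ q ≠ 0 → len U ≤ len P) :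
    ∃ u : U ⟶ D, a ≫ u = d := by
  induction D using isZero_or_indecomposable_induction hL with
  | zero D hD => exact ⟨0, hD.eq_of_tgt _ _⟩
  | indec D hD =>
    by_cases h0 : d = 0
    · exact ⟨0, by simp [h0]⟩
    · have := mono_of_nonzero_from_simple h0
      exact exists_extension_of_len_le hL hI hU (hI D hD) a d (h D (𝟙 D) hD (by simpa))
  | sum A B D i hA hB =>
    obtain ⟨u, hu⟩ := hA (d ≫ i.hom ≫ biprod.fst) fun P q hP hq =>
      h P (i.hom ≫ biprod.fst ≫ q) hP (by simpa using hq)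
    obtain ⟨w, hw⟩ := hB (d ≫ i.hom ≫ biprod.snd) fun P q hP hq =>
      h P (i.hom ≫ biprod.snd ≫ q) hP (by simpa using hq)
    refine ⟨biprod.lift u w ≫ i.inv, ?_⟩
    rw [← cancel_mono i.hom]
    apply biprod.hom_ext <;> simp [hu, hw]

/-- Take an indecomposable `P` of least length detecting `c`. If it is no longer than `V`, it maps
to `V` over `S`; otherwise minimality lets `c` extend to `P` itself. -/
theorem exists_detect_or_exists_longer {S B V : C} [Simple S] (hV : IsUniserial V) (b : S ⟶ V)
    [Mono b] (c : S ⟶ B) (hc : c ≠ 0) :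
    (∃ p : B ⟶ V, c ≫ p ≠ 0) ∨ ∃ (U : C) (a : S ⟶ U) (u : U ⟶ B), IsUniserial U ∧ Mono a ∧
      len V < len U ∧ a ≫ u = c := by
  classical
  have hex : ∃ n, ∃ (P : C) (p : B ⟶ P), Indecomposable P ∧ c ≫ p ≠ 0 ∧ len P = n := by
    obtain ⟨P, p, hP, hp⟩ := exists_indecomposable_comp_ne_zero hL B c hc
    exact ⟨_, P, p, hP, hp, rfl⟩
  obtain ⟨P, p, hP, hp, hn⟩ := Nat.find_spec hex
  have := mono_of_nonzero_from_simple hp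
  rcases le_or_gt (len P) (len V) with h | h
  · obtain ⟨e, he⟩ := exists_extension_of_len_le hL hI (hI P hP) hV (c ≫ p) b h
    refine .inl ⟨p ≫ e, fun h0 => ?_⟩
    rw [← Category.assoc, he] at h0
    exact Simple.not_isZero S (IsZero.of_mono_eq_zero _ h0)
  · obtain ⟨u, hu⟩ := exists_extension_of_forall_len_le hL hI (hI P hP) (c ≫ p) B c
      fun Q q hQ hq => hn ▸ Nat.find_min' hex ⟨Q, q, hQ, hq, rfl⟩
    exact .inr ⟨P, c ≫ p, u, hI P hP, inferInstance, h, hu⟩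

end Comparison

/-! ### Elements of left exact functors -/

section Elements

variable {C : Type u} [Category.{v} C] (F G : Cᵒᵖ ⥤ AddCommGrpCat.{v})

/-- Restriction of elements of a presheaf of abelian groups. -/
def res {A B : C} (h : A ⟶ B) : F.obj (op B) →+ F.obj (op A) := (F.map h.op).hom

@[simp]
theorem res_id {A : C} (x : F.obj (op A)) : res F (𝟙 A) x = x := by
  simp [res]

theorem res_comp {A B D : C} (h : A ⟶ B) (k : B ⟶ D) (x : F.obj (op D)) :
    res F (h ≫ k) x = res F h (res F k x) := by
  simp [res]

variable {F G} in
theorem app_res (φ : F ⟶ G) {A B : C} (h : A ⟶ B) (x : F.obj (op B)) :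
    (φ.app (op A)).hom (res F h x) = res G h ((φ.app (op B)).hom x) :=
  ConcreteCategory.congr_hom (φ.naturality h.op) x

/-- A natural transformation from a natural family of additive maps. -/
def homOfRes (f : ∀ B : C, F.obj (op B) →+ G.obj (op B))
    (hf : ∀ {A B : C} (h : A ⟶ B) (x : F.obj (op B)), f A (res F h x) = res G h (f B x)) :
    F ⟶ G where
  app B := AddCommGrpCat.ofHom (f B.unop)
  naturality A B h := by
    ext x
    exact hf h.unop x

variable [Abelian C] [PreservesFiniteLimits F]

theorem additive_of_preservesFiniteLimits : F.Additive :=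
  Functor.additive_of_preserves_binary_products F

theorem res_add {A B : C} (h k : A ⟶ B) (x : F.obj (op B)) :
    res F (h + k) x = res F h x + res F k x := by
  have := additive_of_preservesFiniteLimits F
  simp [res, Functor.map_add]

@[simp]
theorem res_zero {A B : C} (x : F.obj (op B)) : res F (0 : A ⟶ B) x = 0 := by
  have := additive_of_preservesFiniteLimits F
  simp [res]

omit [Abelian C] in
theorem res_injective {A B : C} (e : A ⟶ B) [Epi e] : Function.Injective (res F e) :=
  (AddCommGrpCat.mono_iff_injective _).1 (inferInstance : Mono (F.map e.op))

theorem eq_zero_of_isZero {A : C} (hA : IsZero A) (x : F.obj (op A)) : x = 0 := by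
  rw [← res_id F x, hA.eq_of_src (𝟙 A) 0, res_zero]

theorem exists_res_eq_of_epi {A B : C} (e : A ⟶ B) [Epi e] (y : F.obj (op A))
    (h : ∀ (K : C) (k : K ⟶ A), k ≫ e = 0 → res F k y = 0) : ∃ z, res F e z = y := by
  let S : ShortComplex Cᵒᵖ := (ShortComplex.mk (kernel.ι e) e (kernel.condition e)).op
  have hS : S.Exact := (ShortComplex.exact_of_g_is_cokernel _
    (Abelian.epiIsCokernelOfKernel _ (kernelIsKernel e))).op
  have := additive_of_preservesFiniteLimits F
  have hm : Mono S.f := (inferInstance : Mono e.op)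
  have := hS.map_of_mono_of_preservesKernel F hm inferInstance
  rw [ShortComplex.ab_exact_iff] at this
  exact this y (h _ _ (kernel.condition e))

/-- Restriction along the epimorphism onto the image of `h` is injective, so `x` vanishes on that
image and descends to the cokernel. -/
theorem exists_res_eq_res_image {A B : C} (h : A ⟶ B) (x : F.obj (op B)) (hx : res F h x = 0) :
    ∃ z, res F (cokernel.π h) z = x := by
  apply exists_res_eq_of_epi
  intro K k hk
  obtain ⟨g, hg⟩ : ∃ g : K ⟶ Abelian.image h, g ≫ Abelian.image.ι h = k :=
    ⟨kernel.lift _ k hk, kernel.lift_ι _ _ _⟩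
  have h0 : res F (Abelian.image.ι h) x = 0 := by
    apply res_injective F (Abelian.factorThruImage h)
    rw [← res_comp, Abelian.image.fac, hx, map_zero]
  rw [← hg, res_comp, h0, map_zero]

end Elements

/-! ### Extending elements from simple subobjects -/

section Extension

variable {C : Type u} [Category.{v} C] [Abelian C] (hL : ∀ X : C, Nonempty (CompSeries X))

theorem mono_cokernel_map {A B D : C} (s : A ⟶ B) (i : B ⟶ D) [Mono s] [Mono i] :
    Mono (cokernel.map s (s ≫ i) (𝟙 A) i (by simp)) := by
  refine Preadditive.mono_of_cancel_zero _ fun {T} k hk => ?_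
  have h1 : (pullback.snd k (cokernel.π s) ≫ i) ≫ cokernel.π (s ≫ i) = 0 := by
    have := pullback.fst k (cokernel.π s) ≫= hk
    rw [← Category.assoc, pullback.condition] at this
    simpa using this
  obtain ⟨l, hl⟩ := KernelFork.IsLimit.lift' (Abelian.monoIsKernelOfCokernel _
    (cokernelIsCokernel (s ≫ i))) _ h1
  have hl : l ≫ s ≫ i = pullback.snd k (cokernel.π s) ≫ i := hl
  rw [← Category.assoc, cancel_mono] at hl
  rw [← cancel_epi (pullback.fst k (cokernel.π s)), pullback.condition, ← hl, Category.assoc,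
    cokernel.condition s, comp_zero, comp_zero]

include hL in
/-- Elements extend along all monomorphisms into uniserial objects of bounded length as soon as
they extend from simple subobjects. -/
theorem exists_extension_of_simple (G : Cᵒᵖ ⥤ AddCommGrpCat.{v}) [PreservesFiniteLimits G] (n : ℕ)
    (hG : ∀ (S U : C) (a : S ⟶ U) (y : G.obj (op S)), Simple S → IsUniserial U → Mono a →
      len U ≤ n → ∃ z, res G a z = y)
    {A U : C} (i : A ⟶ U) [Mono i] (hU : IsUniserial U) (hn : len U ≤ n) (y : G.obj (op A)) :
    ∃ z, res G i z = y := by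
  induction h : len U using Nat.strong_induction_on generalizing A U with
  | _ m ih =>
  subst h
  by_cases hA : IsZero A
  · exact ⟨0, (eq_zero_of_isZero G hA _).trans (eq_zero_of_isZero G hA _).symm⟩
  obtain ⟨S, s, hS, hs⟩ := exists_simple_mono hL A hA
  obtain ⟨z, hz⟩ := hG S U (s ≫ i) (res G s y) hS hU (mono_comp _ _) hn
  -- The error `y - i^* z` vanishes on `S`, so it lives on `A/S`, which embeds in the shorter
  -- uniserial object `U/S`.
  obtain ⟨w, hw⟩ := exists_res_eq_res_image G s (y - res G i z) (by
    rw [map_sub, ← res_comp, hz, sub_self])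
  let j : cokernel s ⟶ cokernel (s ≫ i) := cokernel.map s (s ≫ i) (𝟙 S) i (by simp)
  have hsi : s ≫ i ≠ 0 := fun h0 => Simple.not_isZero S (IsZero.of_mono_eq_zero _ h0)
  have hj : Mono j := mono_cokernel_map s i
  have hlt : len (cokernel (s ≫ i)) < len U := by
    refine len_lt_of_epi (hL U) (cokernel.π (s ≫ i)) fun h0 => hsi ?_
    rw [← cancel_mono (cokernel.π (s ≫ i)), cokernel.condition, zero_comp]
  obtain ⟨t, ht⟩ := ih _ hlt j (hU.of_epi (cokernel.π _)) (hlt.le.trans hn) w rfl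
  refine ⟨z + res G (cokernel.π (s ≫ i)) t, ?_⟩
  have : i ≫ cokernel.π (s ≫ i) = cokernel.π s ≫ j := by simp [j]
  rw [map_add, ← res_comp, this, res_comp, ht, hw]
  abel

end Extension

/-! ### Partial homomorphisms and Zorn's lemma -/

section PartialHom

variable {C : Type u} [Category.{v} C] (F G : Cᵒᵖ ⥤ AddCommGrpCat.{v})

/-- The graph of a natural transformation from a subfunctor of `F` to `G`. -/
structure IsPartialHom (Γ : ∀ B : C, AddSubgroup (F.obj (op B) × G.obj (op B))) : Prop where
  res_mem : ∀ {A B : C} (h : A ⟶ B) {x y}, (x, y) ∈ Γ B → (res F h x, res G h y) ∈ Γ A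
  eq_zero : ∀ {B : C} {y}, (0, y) ∈ Γ B → y = 0

variable {F G}
variable {Γ : ∀ B : C, AddSubgroup (F.obj (op B) × G.obj (op B))}

theorem IsPartialHom.unique (hΓ : IsPartialHom F G Γ) {B : C} {x y y'} (h : (x, y) ∈ Γ B)
    (h' : (x, y') ∈ Γ B) : y = y' := by
  have := (Γ B).sub_mem h h'
  rw [Prod.mk_sub_mk, sub_self] at this
  exact sub_eq_zero.1 (hΓ.eq_zero this)

theorem exists_maximal_partialHom (h0 : IsPartialHom F G Γ) :
    ∃ Δ, Γ ≤ Δ ∧ Maximal (IsPartialHom F G) Δ := by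
  refine zorn_le_nonempty₀ {Δ | IsPartialHom F G Δ} (fun c hc hchain y hy => ?_) Γ h0
  have : Nonempty c := ⟨⟨y, hy⟩⟩
  have key : ∀ (B : C) (p), p ∈ sSup c B ↔ ∃ Δ ∈ c, p ∈ Δ B := by
    intro B p
    rw [sSup_apply, AddSubgroup.mem_iSup_of_directed]
    · simp
    · intro a b
      rcases hchain.total a.2 b.2 with h | h
      · exact ⟨b, h B, le_rfl⟩
      · exact ⟨a, le_rfl, h B⟩
  refine ⟨sSup c, ⟨fun h x y hxy => ?_, fun hy => ?_⟩, fun z hz => le_sSup hz⟩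
  · obtain ⟨Δ, hΔ, h1⟩ := (key _ _).1 hxy
    exact (key _ _).2 ⟨Δ, hΔ, (hc hΔ).res_mem h h1⟩
  · obtain ⟨Δ, hΔ, h1⟩ := (key _ _).1 hy
    exact (hc hΔ).eq_zero h1

variable [Abelian C] [PreservesFiniteLimits F] [PreservesFiniteLimits G]

variable (F) in
/-- The additive map `h ↦ h^* x`. -/
def resHom {B : C} (x : F.obj (op B)) (A : C) : (A ⟶ B) →+ F.obj (op A) where
  toFun h := res F h x
  map_zero' := res_zero F x
  map_add' h k := res_add F h k x

/-- By `hxy`, adjoining `(x, y)` and its restrictions keeps the graph single-valued, so maximality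
already contains the pair. -/
theorem mem_of_maximal (hΓ : Maximal (IsPartialHom F G) Γ) {B : C} (x : F.obj (op B))
    (y : G.obj (op B)) (hxy : ∀ (A : C) (h : A ⟶ B) w, (res F h x, w) ∈ Γ A → w = res G h y) :
    (x, y) ∈ Γ B := by
  let Δ : ∀ A : C, AddSubgroup (F.obj (op A) × G.obj (op A)) := fun A =>
    Γ A ⊔ ((resHom F x A).prod (resHom G y A)).range
  have hmem : ∀ {A p}, p ∈ Δ A ↔ ∃ q ∈ Γ A, ∃ h : A ⟶ B, q + (res F h x, res G h y) = p := by
    intro A p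
    simp only [Δ, AddSubgroup.mem_sup, AddMonoidHom.mem_range, exists_exists_eq_and]
    rfl
  have hΔ : IsPartialHom F G Δ := by
    refine ⟨fun {A D} k u w h => ?_, fun {A} w h => ?_⟩
    · obtain ⟨⟨z, t⟩, hq, h, he⟩ := hmem.1 h
      simp only [Prod.mk_add_mk, Prod.mk.injEq] at he
      refine hmem.2 ⟨_, hΓ.prop.res_mem k hq, k ≫ h, ?_⟩
      rw [← he.1, ← he.2, map_add, map_add, res_comp, res_comp]
      rfl
    · obtain ⟨⟨z, t⟩, hq, h, he⟩ := hmem.1 h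
      simp only [Prod.mk_add_mk, Prod.mk.injEq] at he
      have hq' := (Γ A).neg_mem hq
      rw [Prod.neg_mk, neg_eq_of_add_eq_zero_right he.1] at hq'
      rw [← he.2, ← hxy A h _ hq', add_neg_cancel]
  exact hΓ.le_of_ge hΔ (fun A => le_sup_left) B
    (hmem.2 ⟨0, zero_mem _, 𝟙 B, by simp⟩)

theorem exists_mem_of_epi (hΓ : Maximal (IsPartialHom F G) Γ) {D B : C} (e : D ⟶ B) [Epi e]
    (x : F.obj (op B)) (w : G.obj (op D)) (h : (res F e x, w) ∈ Γ D) :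
    ∃ y, res G e y = w ∧ (x, y) ∈ Γ B := by
  obtain ⟨y, hy⟩ := exists_res_eq_of_epi G e w fun K k hk => by
    have := hΓ.prop.res_mem k h
    rw [← res_comp, hk, res_zero] at this
    exact hΓ.prop.eq_zero this
  refine ⟨y, hy, mem_of_maximal hΓ x y fun A k v hv => ?_⟩
  apply res_injective G (pullback.fst k e)
  rw [← res_comp, pullback.condition, res_comp, hy]
  refine hΓ.prop.unique (hΓ.prop.res_mem (pullback.fst k e) hv) ?_
  rw [← res_comp, pullback.condition, res_comp]
  exact hΓ.prop.res_mem (pullback.snd k e) h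

variable (hL : ∀ X : C, Nonempty (CompSeries X))
include hL

theorem exists_mem_of_isUniserial (hΓ : Maximal (IsPartialHom F G) Γ) {B : C} (hB : IsUniserial B)
    (hext : ∀ (A : C) (i : A ⟶ B) x y, Mono i → (res F i x, y) ∈ Γ A → ∃ z, res G i z = y)
    (x : F.obj (op B)) : ∃ y, (x, y) ∈ Γ B := by
  classical
  -- Minimizing `len B - len A` picks a largest subobject on which the restriction of `x` has a
  -- value; the zero subobject, as `kernel (𝟙 B)`, starts the search.
  have hex : ∃ n, ∃ (A : C) (i : A ⟶ B) (y : G.obj (op A)), Mono i ∧ (res F i x, y) ∈ Γ A ∧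
      len B - len A = n := by
    have h0 : kernel.ι (𝟙 B) = 0 := by simpa using kernel.condition (𝟙 B)
    refine ⟨_, kernel (𝟙 B), kernel.ι (𝟙 B), 0, inferInstance, ?_, rfl⟩
    rw [h0, res_zero]
    exact zero_mem _
  obtain ⟨A, i, y₀, hi, hy₀, hn⟩ := Nat.find_spec hex
  obtain ⟨y, rfl⟩ := hext A i x y₀ hi hy₀
  refine ⟨y, mem_of_maximal hΓ x y fun D h w hw => ?_⟩
  rw [← image.fac h, res_comp] at hw
  obtain ⟨w', rfl, hw'⟩ := exists_mem_of_epi hΓ _ _ _ hw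
  have hfac : ∃ c, c ≫ i = image.ι h := by
    rcases hB (image.ι h) i with hc | ⟨c, hc⟩
    · exact hc
    · have : Mono c := by
        have : Mono (c ≫ image.ι h) := hc ▸ inferInstance
        exact mono_of_mono c (image.ι h)
      have h1 := Nat.find_min' hex ⟨_, image.ι h, w', inferInstance, hw', rfl⟩
      have h2 := len_le_of_mono hL (image.ι h)
      have := isIso_of_mono_of_len_le hL c (by omega)
      exact ⟨inv c, by simp [← hc]⟩
  obtain ⟨c, hc⟩ := hfac
  have : w' = res G (image.ι h) y := by
    refine hΓ.prop.unique hw' ?_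
    rw [← hc, res_comp, res_comp]
    exact hΓ.prop.res_mem c hy₀
  rw [this, ← res_comp, image.fac]

/-- A partial homomorphism extends to a homomorphism if the elements in its range extend along
subobjects of uniserial objects. -/
theorem exists_hom_of_isPartialHom (hI : ∀ X : C, Indecomposable X → IsUniserial X)
    (h0 : IsPartialHom F G Γ)
    (hext : ∀ Δ, Γ ≤ Δ → IsPartialHom F G Δ → ∀ (A B : C) (i : A ⟶ B) x y, Mono i →
      IsUniserial B → (res F i x, y) ∈ Δ A → ∃ z, res G i z = y) :
    ∃ φ : F ⟶ G, ∀ (B : C) x y, (x, y) ∈ Γ B → (φ.app (op B)).hom x = y := by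
  obtain ⟨Δ, hle, hΔ⟩ := exists_maximal_partialHom h0
  have htot : ∀ (B : C) (x : F.obj (op B)), ∃ y, (x, y) ∈ Δ B := by
    intro B
    induction B using isZero_or_indecomposable_induction hL with
    | zero B hB => exact fun x => ⟨0, by rw [eq_zero_of_isZero F hB x]; exact zero_mem _⟩
    | indec B hB =>
      exact exists_mem_of_isUniserial hL hΔ (hI B hB) fun A i x y hi =>
        hext Δ hle hΔ.prop A B i x y hi (hI B hB)
    | sum A B D i hA hB =>
      intro x
      obtain ⟨y, hy⟩ := hA (res F (biprod.inl ≫ i.inv) x)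
      obtain ⟨z, hz⟩ := hB (res F (biprod.inr ≫ i.inv) x)
      have := (Δ D).add_mem (hΔ.prop.res_mem (i.hom ≫ biprod.fst) hy)
        (hΔ.prop.res_mem (i.hom ≫ biprod.snd) hz)
      rw [Prod.mk_add_mk, ← res_comp, ← res_comp, ← res_add] at this
      have hid : (i.hom ≫ biprod.fst) ≫ biprod.inl ≫ i.inv +
          (i.hom ≫ biprod.snd) ≫ biprod.inr ≫ i.inv = 𝟙 D := by
        rw [Category.assoc, Category.assoc, ← Preadditive.comp_add, ← Category.assoc biprod.fst,
          ← Category.assoc biprod.snd, ← Preadditive.add_comp, biprod.total, Category.id_comp,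
          i.hom_inv_id]
      rw [hid, res_id] at this
      exact ⟨_, this⟩
  choose f hf using htot
  refine ⟨homOfRes F G (fun B => AddMonoidHom.mk' (f B) fun x y => ?_) fun {A B} h x => ?_,
    fun B x y h => ?_⟩
  · exact hΔ.prop.unique (hf B _) ((Δ B).add_mem (hf B x) (hf B y))
  · exact hΔ.prop.unique (hf A _) (hΔ.prop.res_mem h (hf B x))
  · exact hΔ.prop.unique (hf B x) (hle B h)

end PartialHom

/-! ### Left exact functors: summands, indecomposability, injectivity -/

section Lex

variable {C : Type u} [Category.{v} C]

instance (X : LexCat C) : PreservesFiniteLimits X.obj := X.property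

instance lex_hasKernels : HasKernels (LexCat C) :=
  ⟨fun _ => inferInstance⟩

/-- The action of a morphism of left exact functors on elements. -/
def lexApp {X Y : LexCat C} (φ : X ⟶ Y) {B : C} : X.obj.obj (op B) →+ Y.obj.obj (op B) :=
  (φ.hom.app (op B)).hom

theorem lexApp_comp {X Y Z : LexCat C} (φ : X ⟶ Y) (ψ : Y ⟶ Z) {B : C} (x : X.obj.obj (op B)) :
    lexApp (φ ≫ ψ) x = lexApp ψ (lexApp φ x) := rfl

@[simp]
theorem lexApp_id {X : LexCat C} {B : C} (x : X.obj.obj (op B)) : lexApp (𝟙 X) x = x := rfl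

theorem lexApp_add {X Y : LexCat C} (φ ψ : X ⟶ Y) {B : C} (x : X.obj.obj (op B)) :
    lexApp (φ + ψ) x = lexApp φ x + lexApp ψ x := rfl

@[simp]
theorem lexApp_zero {X Y : LexCat C} {B : C} (x : X.obj.obj (op B)) :
    lexApp (0 : X ⟶ Y) x = 0 := rfl

theorem lexApp_res {X Y : LexCat C} (φ : X ⟶ Y) {A B : C} (h : A ⟶ B) (x : X.obj.obj (op B)) :
    lexApp φ (res X.obj h x) = res Y.obj h (lexApp φ x) := app_res φ.hom h x

theorem lex_hom_ext {X Y : LexCat C} {φ ψ : X ⟶ Y}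
    (h : ∀ (B : C) (x : X.obj.obj (op B)), lexApp φ x = lexApp ψ x) : φ = ψ := by
  apply ObjectProperty.hom_ext
  ext B x
  exact h B.unop x

theorem exists_ne_zero_of_not_isZero {X : LexCat C} (hX : ¬ IsZero X) :
    ∃ (B : C) (x : X.obj.obj (op B)), x ≠ 0 := by
  by_contra! h
  exact hX ((IsZero.iff_id_eq_zero X).2 (lex_hom_ext fun B x => (h B x).trans rfl))

theorem lex_mono_of_injective {X Y : LexCat C} (φ : X ⟶ Y)
    (h : ∀ (B : C) (x : X.obj.obj (op B)), lexApp φ x = 0 → x = 0) : Mono φ := by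
  refine Preadditive.mono_of_cancel_zero _ fun {Z} ψ hψ => lex_hom_ext fun B x => h B _ ?_
  rw [← lexApp_comp, hψ, lexApp_zero]

theorem isDirectSummand_of_retract {A : Type*} [Category* A] [Preadditive A]
    [HasBinaryBiproducts A] [HasKernels A] {X Y : A} (s : Y ⟶ X) (r : X ⟶ Y) (h : s ≫ r = 𝟙 Y) :
    IsDirectSummand Y X := by
  have : IsSplitEpi r := ⟨⟨⟨s, h⟩⟩⟩
  exact ⟨_, ⟨biprod.uniqueUpToIso _ _
    (isBilimitBinaryBiconeOfIsSplitEpiOfKernel (kernelIsKernel r)) ≪≫ biprod.braiding _ _⟩⟩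

variable [Abelian C]

/-- The morphism from a representable functor determined by an element. -/
noncomputable def elemHom (X : LexCat C) {B : C} (x : X.obj.obj (op B)) :
    (lexYoneda C).obj B ⟶ X :=
  ObjectProperty.homMk (homOfRes (preadditiveYoneda.obj B) X.obj (resHom X.obj x)
    fun h k => res_comp X.obj h k x)

theorem elemHom_app (X : LexCat C) {A B : C} (x : X.obj.obj (op B)) (h : A ⟶ B) :
    lexApp (elemHom X x) (show ((lexYoneda C).obj B).obj.obj (op A) from h) = res X.obj h x := rfl

theorem lex_injective_of_mono {X Y : LexCat C} (φ : X ⟶ Y) [Mono φ] {B : C}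
    (x : X.obj.obj (op B)) (hx : lexApp φ x = 0) : x = 0 := by
  have h : elemHom X x = 0 := by
    rw [← cancel_mono φ, zero_comp]
    refine lex_hom_ext fun A (h : A ⟶ B) => ?_
    change lexApp φ (res X.obj h x) = 0
    rw [lexApp_res, hx, map_zero]
  have h2 := elemHom_app X x (𝟙 B)
  rw [h, res_id] at h2
  exact h2.symm

omit [Abelian C] in
/-- If every nonzero element restricts to a multiple of `f` then the functor is
indecomposable. -/
theorem indecomposable_of_essential {Y : LexCat C} {S : C} (f : Y.obj.obj (op S)) (hf : f ≠ 0)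
    (h : ∀ (B : C) (y : Y.obj.obj (op B)), y ≠ 0 →
      ∃ (D : C) (d : D ⟶ B) (e : D ⟶ S), Epi e ∧ res Y.obj d y = res Y.obj e f) :
    Indecomposable Y := by
  -- A morphism not killing `f` kills no nonzero element, so a summand inside its kernel is zero.
  have key : ∀ {Z W : LexCat C} (φ : Y ⟶ Z) (j : W ⟶ Y) (p : Y ⟶ W), lexApp φ f ≠ 0 →
      j ≫ φ = 0 → j ≫ p = 𝟙 W → IsZero W := by
    intro Z W φ j p hφ h1 h2
    refine (IsZero.iff_id_eq_zero W).2 (lex_hom_ext fun B w => ?_)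
    rw [← h2, lexApp_comp, lexApp_zero]
    by_cases hw : lexApp j w = 0
    · rw [hw, map_zero]
    · obtain ⟨D, d, e, he, hde⟩ := h B _ hw
      refine absurd (res_injective Z.obj e ?_) hφ
      rw [← lexApp_res, ← hde, lexApp_res, ← lexApp_comp, h1, lexApp_zero, map_zero, map_zero]
  refine ⟨fun h0 => hf ?_, fun Y₁ Y₂ i => ?_⟩
  · rw [← lexApp_id f, (IsZero.iff_id_eq_zero Y).1 h0, lexApp_zero]
  · by_cases h1 : lexApp (i.hom ≫ biprod.fst) f = 0
    · by_cases h2 : lexApp (i.hom ≫ biprod.snd) f = 0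
      · refine absurd ?_ hf
        have hid : (i.hom ≫ biprod.fst) ≫ biprod.inl ≫ i.inv +
            (i.hom ≫ biprod.snd) ≫ biprod.inr ≫ i.inv = 𝟙 Y := by
          rw [Category.assoc, Category.assoc, ← Preadditive.comp_add, ← Category.assoc biprod.fst,
            ← Category.assoc biprod.snd, ← Preadditive.add_comp, biprod.total, Category.id_comp,
            i.hom_inv_id]
        rw [← lexApp_id f, ← hid, lexApp_add, lexApp_comp, h1, lexApp_comp (i.hom ≫ biprod.snd),
          h2, map_zero, map_zero, add_zero]
      · exact .inl (key _ (biprod.inl ≫ i.inv) (i.hom ≫ biprod.fst) h2 (by simp) (by simp))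
    · exact .inr (key _ (biprod.inr ≫ i.inv) (i.hom ≫ biprod.snd) h1 (by simp) (by simp))

/-- A criterion for injectivity in the style of Baer. -/
theorem injective_of_extension (hL : ∀ X : C, Nonempty (CompSeries X))
    (hI : ∀ X : C, Indecomposable X → IsUniserial X) (Y : LexCat C)
    (hY : ∀ (S U : C) (a : S ⟶ U) (y : Y.obj.obj (op S)), Simple S → IsUniserial U → Mono a →
      ∃ z, res Y.obj a z = y) : Injective Y where
  factors {X Z} g f _ := by
    let Γ : ∀ B : C, AddSubgroup (Z.obj.obj (op B) × Y.obj.obj (op B)) := fun B =>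
      ((lexApp f (B := B)).prod (lexApp g)).range
    have hΓ : IsPartialHom Z.obj Y.obj Γ := by
      refine ⟨?_, ?_⟩
      · rintro A B h x y ⟨w, hw⟩
        obtain ⟨rfl, rfl⟩ := Prod.mk.inj hw
        exact ⟨res X.obj h w, Prod.ext (lexApp_res f h w) (lexApp_res g h w)⟩
      · rintro B y ⟨w, hw⟩
        obtain ⟨h1, rfl⟩ := Prod.mk.inj hw
        rw [lex_injective_of_mono f w h1, map_zero]
    obtain ⟨φ, hφ⟩ := exists_hom_of_isPartialHom hL hI hΓ fun Δ _ _ A B i x y _ hB _ =>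
      exists_extension_of_simple hL Y.obj (len B) (fun S U a y hS hU ha _ => hY S U a y hS hU ha)
        i hB le_rfl y
    exact ⟨ObjectProperty.homMk φ, lex_hom_ext fun B x => hφ B _ _ ⟨x, rfl⟩⟩

section SubFunctor

variable (X : LexCat C) (K : ∀ B : C, AddSubgroup (X.obj.obj (op B)))
  (hK : ∀ {A B : C} (h : A ⟶ B) (x), x ∈ K B → res X.obj h x ∈ K A)

/-- The subfunctor of a left exact functor given by a family of subgroups. -/
def subFunctor : Cᵒᵖ ⥤ AddCommGrpCat.{v} where
  obj B := AddCommGrpCat.of (K B.unop)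
  map {A B} h := AddCommGrpCat.ofHom
    (((res X.obj h.unop).comp (K A.unop).subtype).codRestrict (K B.unop)
      fun x => hK h.unop x.1 x.2)
  map_id A := by
    ext x
    exact res_id X.obj x.1
  map_comp {A B D} h k := by
    ext x
    exact res_comp X.obj k.unop h.unop x.1

/-- Exactness for `X` supplies the preimage `z`; descent along epimorphisms (`hK'`) puts it in `K`.
-/
theorem subFunctor_preservesFiniteLimits
    (hK' : ∀ {A B : C} (e : A ⟶ B) [Epi e] (x), res X.obj e x ∈ K A → x ∈ K B) :
    PreservesFiniteLimits (subFunctor X K hK) := by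
  have : (subFunctor X K hK).Additive := ⟨fun {A B h k} => by
    ext x
    exact Subtype.ext (res_add X.obj h.unop k.unop x.1)⟩
  have := additive_of_preservesFiniteLimits X.obj
  refine ((Functor.preservesFiniteLimits_tfae (subFunctor X K hK)).out 0 3 rfl rfl).1 fun S hS => ?_
  have := hS.mono_f
  refine ⟨?_, ?_⟩
  · rw [ShortComplex.ab_exact_iff]
    intro y hy
    have h1 := hS.exact.map_of_mono_of_preservesKernel X.obj hS.mono_f inferInstance
    rw [ShortComplex.ab_exact_iff] at h1
    obtain ⟨z, hz⟩ := h1 y.1 (congrArg Subtype.val hy)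
    exact ⟨⟨z, hK' S.f.unop z (by
      have : res X.obj S.f.unop z = y.1 := hz
      rw [this]
      exact y.2)⟩, Subtype.ext hz⟩
  · rw [AddCommGrpCat.mono_iff_injective]
    intro x y hxy
    exact Subtype.ext (res_injective X.obj S.f.unop (congrArg Subtype.val hxy))

end SubFunctor

end Lex

/-! ### Splitting off a maximal stage -/

section Retraction

variable {C : Type u} [Category.{v} C] [Abelian C]

/-- The image of `a` contains the socle; pull the socle back to `A`. -/
theorem IsUniserial.exists_epi_of_ne_zero {V S A : C} [Simple S] (hV : IsUniserial V) (b : S ⟶ V)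
    [Mono b] (a : A ⟶ V) (ha : a ≠ 0) :
    ∃ (D : C) (d : D ⟶ A) (e : D ⟶ S), Epi e ∧ d ≫ a = e ≫ b := by
  obtain ⟨c, hc⟩ := hV.exists_fac_of_mono b (Abelian.image.ι a) fun h0 => ha (by
    rw [← Abelian.image.fac a, h0.eq_zero_of_src (Abelian.image.ι a), comp_zero])
  refine ⟨pullback c (Abelian.factorThruImage a), pullback.snd _ _, pullback.fst _ _,
    inferInstance, ?_⟩
  rw [← hc, pullback.condition_assoc, Abelian.image.fac]

/-- A morphism is null for `V` if its composite with every morphism to `V` vanishes. -/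
def IsNull (V : C) {A B : C} (h : A ⟶ B) : Prop :=
  ∀ p : B ⟶ V, h ≫ p = 0

variable (hL : ∀ X : C, Nonempty (CompSeries X)) (hI : ∀ X : C, Indecomposable X → IsUniserial X)
include hL

/-- Whenever a nonzero `h` kills the element, it descends to the cokernel of `h`, which is shorter.
-/
theorem exists_injective_element (F : Cᵒᵖ ⥤ AddCommGrpCat.{v}) [PreservesFiniteLimits F] (B : C)
    (x : F.obj (op B)) :
    ∃ (D : C) (q : B ⟶ D) (z : F.obj (op D)), res F q z = x ∧
      ∀ (A : C) (h : A ⟶ D), res F h z = 0 → h = 0 := by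
  induction h : len B using Nat.strong_induction_on generalizing B with
  | _ n ih =>
  subst h
  by_cases hx : ∀ (A : C) (h : A ⟶ B), res F h x = 0 → h = 0
  · exact ⟨B, 𝟙 B, x, res_id F x, hx⟩
  push Not at hx
  obtain ⟨A, h, h0, hne⟩ := hx
  obtain ⟨z, rfl⟩ := exists_res_eq_res_image F h x h0
  obtain ⟨D, q, w, rfl, hw⟩ := ih _ (len_lt_of_epi (hL B) (cokernel.π h) fun hiso => hne (by
    rw [← cancel_mono (cokernel.π h), cokernel.condition, zero_comp])) _ z rfl
  exact ⟨D, cokernel.π h ≫ q, w, res_comp F _ _ _, hw⟩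

include hI

theorem exists_extension_of_kills_null {V : C} (hV : IsUniserial V) {A B : C} (i : A ⟶ B) [Mono i]
    (hB : IsUniserial B) (y : A ⟶ V)
    (hy : ∀ (D : C) (h : D ⟶ A), IsNull V (h ≫ i) → h ≫ y = 0) : ∃ z, i ≫ z = y := by
  induction h : len B using Nat.strong_induction_on generalizing A B with
  | _ m ih =>
  subst h
  by_cases hA : IsZero A
  · exact ⟨0, hA.eq_of_src _ _⟩
  obtain ⟨S, s, hS, hs⟩ := exists_simple_mono hL A hA
  by_cases hp : IsNull V (s ≫ i)
  · have hsi : s ≫ i ≠ 0 := fun h0 => Simple.not_isZero S (IsZero.of_mono_eq_zero _ h0)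
    have hlt : len (cokernel (s ≫ i)) < len B := by
      refine len_lt_of_epi (hL B) (cokernel.π (s ≫ i)) fun h0 => hsi ?_
      rw [← cancel_mono (cokernel.π (s ≫ i)), cokernel.condition, zero_comp]
    let j : cokernel s ⟶ cokernel (s ≫ i) := cokernel.map s (s ≫ i) (𝟙 S) i (by simp)
    have hj : Mono j := mono_cokernel_map s i
    have hij : i ≫ cokernel.π (s ≫ i) = cokernel.π s ≫ j := by simp [j]
    obtain ⟨z, hz⟩ := ih _ hlt j (hB.of_epi (cokernel.π _))
      (cokernel.desc s y (hy S s hp)) (fun D h hn => by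
        rw [← cancel_epi (pullback.fst h (cokernel.π s)), pullback.condition_assoc,
          cokernel.π_desc, comp_zero]
        -- Every `p : B ⟶ V` kills the null socle, hence factors through `B/S`; so nullness over the
        -- quotient lifts to `B`.
        refine hy _ _ fun p => ?_
        rw [← cokernel.π_desc (s ≫ i) p (hp p), Category.assoc, reassoc_of% hij,
          ← pullback.condition_assoc]
        have := hn (cokernel.desc (s ≫ i) p (hp p))
        rw [Category.assoc] at this
        rw [this, comp_zero]) rfl
    refine ⟨cokernel.π (s ≫ i) ≫ z, ?_⟩
    rw [reassoc_of% hij, hz, cokernel.π_desc]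
  -- A `p` detecting the socle is mono, so `len B ≤ len V` and the comparison lemma makes `Hom(-,
  -- V)` extend elements from simple objects.
  · obtain ⟨p, hp⟩ : ∃ p, (s ≫ i) ≫ p ≠ 0 := by simpa [IsNull] using hp
    have := hB.mono_of_comp_ne_zero (s ≫ i) p hp
    refine exists_extension_of_simple hL (preadditiveYoneda.obj V) (len V)
      (fun S U a y hS hU ha hn => ?_) i hB (len_le_of_mono hL p) y
    let y : S ⟶ V := y
    by_cases h0 : y = 0
    · exact ⟨0, (map_zero _).trans h0.symm⟩
    · have := mono_of_nonzero_from_simple h0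
      exact exists_extension_of_len_le hL hI hU hV a y hn

/-- If an element `f` supported on a simple object extends to `g` on a uniserial object `V`, but
not to any longer one, then `g` is the inclusion of a direct summand. -/
theorem exists_retraction_of_maximal (F : Cᵒᵖ ⥤ AddCommGrpCat.{v}) [PreservesFiniteLimits F]
    {S V : C} [Simple S] (hV : IsUniserial V) (b : S ⟶ V) [Mono b] (g : F.obj (op V))
    (hne : res F b g ≠ 0)
    (hmax : ∀ (U : C) (a : S ⟶ U) (w : F.obj (op U)), IsUniserial U → Mono a → len V < len U →
      res F a w ≠ res F b g) :
    ∃ φ : F ⟶ preadditiveYoneda.obj V,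
      (φ.app (op V)).hom g = (show (preadditiveYoneda.obj V).obj (op V) from 𝟙 V) := by
  -- Well-definedness. If `a ≠ 0`, the socle element `b^* g` comes from some `c : S ⟶ B₁`. A
  -- morphism `B₁ ⟶ V` detecting `c` contradicts nullness of `h`; a longer uniserial extension of
  -- `c` contradicts `hmax`.
  have hsv : ∀ {A B : C} (a : A ⟶ V) (h : A ⟶ B) (x : F.obj (op B)), IsNull V h →
      res F h x = res F a g → a = 0 := by
    intro A B a h x hn hx
    by_contra ha
    obtain ⟨D, d, e, he, hde⟩ := hV.exists_epi_of_ne_zero b a ha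
    obtain ⟨B₁, q, x₁, rfl, hinj⟩ := exists_injective_element hL F B x
    have h1 : res F (d ≫ h ≫ q) x₁ = res F e (res F b g) := by
      rw [← res_comp F e, ← hde, res_comp, res_comp F h, hx, res_comp]
    have h2 : kernel.ι e ≫ d ≫ h ≫ q = 0 := by
      apply hinj
      rw [res_comp, h1, ← res_comp, kernel.condition, res_zero]
    obtain ⟨c, hc⟩ : ∃ c, e ≫ c = d ≫ h ≫ q := ⟨Abelian.epiDesc e _ h2, Abelian.comp_epiDesc e _ h2⟩
    have h3 : res F c x₁ = res F b g := by
      apply res_injective F e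
      rw [← res_comp, hc, h1]
    have hc0 : c ≠ 0 := fun h0 => hne (by rw [← h3, h0, res_zero])
    rcases exists_detect_or_exists_longer hL hI hV b c hc0 with ⟨p, hp⟩ | ⟨U, a', u, hU, ha', hlt, hu⟩
    · apply hp
      rw [← cancel_epi e, reassoc_of% hc, hn, comp_zero, comp_zero]
    · exact hmax U a' (res F u x₁) hU ha' hlt (by rw [← res_comp, hu, h3])
  let Γ : ∀ A : C, AddSubgroup (F.obj (op A) × (preadditiveYoneda.obj V).obj (op A)) := fun A =>
    { carrier := {p | ∃ (B : C) (h : A ⟶ B) (x : F.obj (op B)), IsNull V h ∧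
        p.1 = res F h x + res F (show A ⟶ V from p.2) g}
      zero_mem' := ⟨A, 0, 0, fun p => zero_comp, by
        change (0 : F.obj (op A)) = res F 0 0 + res F (0 : A ⟶ V) g
        simp⟩
      add_mem' := by
        rintro ⟨x, (p : A ⟶ V)⟩ ⟨y, (q : A ⟶ V)⟩ ⟨B, h, x', hn, hx⟩ ⟨D, k, y', hn', hy⟩
        refine ⟨B ⊞ D, biprod.lift h k, res F biprod.fst x' + res F biprod.snd y', ?_, ?_⟩
        · intro p
          have hp : p = biprod.desc (biprod.inl ≫ p) (biprod.inr ≫ p) := by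
            apply biprod.hom_ext' <;> simp
          rw [hp, biprod.lift_desc, hn, hn', add_zero]
        · change x = res F h x' + res F p g at hx
          change y = res F k y' + res F q g at hy
          change x + y = _ + res F (p + q) g
          rw [map_add, ← res_comp, ← res_comp, biprod.lift_fst, biprod.lift_snd, res_add, hx, hy]
          abel
      neg_mem' := by
        rintro ⟨x, (p : A ⟶ V)⟩ ⟨B, h, x', hn, hx⟩
        refine ⟨B, h, -x', hn, ?_⟩
        change x = res F h x' + res F p g at hx
        change -x = res F h (-x') + resHom F g A (-p)
        rw [map_neg, map_neg, hx, neg_add]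
        rfl }
  have hΓ : IsPartialHom F (preadditiveYoneda.obj V) Γ := by
    refine ⟨?_, ?_⟩
    · rintro A A' k x (p : A' ⟶ V) ⟨B, h, x', hn, hx⟩
      change x = res F h x' + res F p g at hx
      refine ⟨B, k ≫ h, x', fun p => by rw [Category.assoc, hn, comp_zero], ?_⟩
      change res F k x = res F (k ≫ h) x' + res F (k ≫ p) g
      rw [hx, map_add, res_comp, res_comp]
    · rintro A (p : A ⟶ V) ⟨B, h, x', hn, hx⟩
      change 0 = res F h x' + res F p g at hx
      refine hsv p h (-x') hn ?_
      rw [map_neg, neg_eq_iff_add_eq_zero, hx]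
  obtain ⟨φ, hφ⟩ := exists_hom_of_isPartialHom hL hI hΓ fun Δ hle hΔ A B i x y hi hB hxy => by
    let y : A ⟶ V := y
    refine exists_extension_of_kills_null hL hI hV i hB y fun D h hn => ?_
    have h1 := hΔ.res_mem h hxy
    rw [← res_comp] at h1
    -- When `h ≫ i` is null, `Γ` already assigns the value `0` to this restriction of `x`.
    refine hΔ.unique h1 (hle D ⟨B, h ≫ i, x, hn, ?_⟩)
    change _ = _ + res F (0 : D ⟶ V) g
    rw [res_zero, add_zero]
  refine ⟨φ, hφ V g _ ⟨V, 0, 0, fun p => zero_comp, ?_⟩⟩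
  change g = _ + res F (𝟙 V) g
  simp

end Retraction

/-! ### Unbounded stages and the injective summand -/

section Chain

variable {C : Type u} [Category.{v} C] [Abelian C]

/-- A uniserial object with an element that extends `f` along the inclusion of the socle `S`. -/
structure Stage (X : LexCat C) {S : C} (f : X.obj.obj (op S)) where
  V : C
  b : S ⟶ V
  g : X.obj.obj (op V)
  mono : Mono b
  isUniserial : IsUniserial V
  res_eq : res X.obj b g = f

variable (hL : ∀ X : C, Nonempty (CompSeries X)) (hI : ∀ X : C, Indecomposable X → IsUniserial X)
  {X : LexCat C} {S : C} {f : X.obj.obj (op S)}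

/-- The stage supported on `S` itself. -/
def Stage.base (hS : IsUniserial S) (f : X.obj.obj (op S)) : Stage X f :=
  ⟨S, 𝟙 S, f, inferInstance, hS, res_id _ _⟩

theorem Stage.eq_zero_of_res_eq_zero [Simple S] (hf : f ≠ 0) (s : Stage X f) {A : C} (h : A ⟶ s.V)
    (h0 : res X.obj h s.g = 0) : h = 0 := by
  by_contra hne
  have := s.mono
  obtain ⟨D, d, e, he, hde⟩ := s.isUniserial.exists_epi_of_ne_zero s.b h hne
  refine hf (res_injective X.obj e ?_)
  rw [← s.res_eq, ← res_comp, ← hde, res_comp, h0, map_zero, map_zero]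

theorem Stage.mono_of_comp_eq [Simple S] (s t : Stage X f) (c : s.V ⟶ t.V) (h : s.b ≫ c = t.b) :
    Mono c := by
  have := s.mono
  have := t.mono
  exact s.isUniserial.mono_of_comp_ne_zero s.b c fun h0 => Simple.not_isZero S
    (IsZero.of_mono_eq_zero t.b (h ▸ h0))

include hL hI

/-- A stage over `y` at least as long as `U` receives `U` over the socle; restrict its element. -/
theorem exists_extension_of_stages
    (hX : ∀ (S : C) (f : X.obj.obj (op S)), Simple S → f ≠ 0 → ∀ s : Stage X f,
      ∃ t : Stage X f, len s.V < len t.V)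
    (S U : C) (a : S ⟶ U) (y : X.obj.obj (op S)) (hS : Simple S) (hU : IsUniserial U)
    (_ : Mono a) : ∃ z, res X.obj a z = y := by
  by_cases hy : y = 0
  · exact ⟨0, (map_zero _).trans hy.symm⟩
  have key : ∀ n, ∃ t : Stage X y, n ≤ len t.V := by
    intro n
    induction n with
    | zero => exact ⟨Stage.base (hI S (indecomposable_of_simple S)) y, Nat.zero_le _⟩
    | succ n ih =>
      obtain ⟨s, hs⟩ := ih
      obtain ⟨t, ht⟩ := hX S y hS hy s
      exact ⟨t, by omega⟩
  obtain ⟨t, ht⟩ := key (len U)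
  have := t.mono
  obtain ⟨c, hc⟩ := exists_extension_of_len_le hL hI hU t.isUniserial a t.b ht
  exact ⟨res X.obj c t.g, by rw [← res_comp, hc, t.res_eq]⟩

theorem Stage.exists_next [Simple S]
    (hext : ∀ (S U : C) (a : S ⟶ U) (y : X.obj.obj (op S)), Simple S → IsUniserial U → Mono a →
      ∃ z, res X.obj a z = y) (s : Stage X f) (hs : ∃ t : Stage X f, len s.V < len t.V) :
    ∃ t : Stage X f, len s.V < len t.V ∧ ∃ c : s.V ⟶ t.V, s.b ≫ c = t.b ∧ res X.obj c t.g = s.g := by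
  obtain ⟨t, ht⟩ := hs
  have := s.mono
  have := t.mono
  obtain ⟨c, hc⟩ := exists_extension_of_len_le hL hI s.isUniserial t.isUniserial s.b t.b ht.le
  have := s.mono_of_comp_eq t c hc
  obtain ⟨z, hz⟩ := exists_extension_of_simple hL X.obj (len t.V)
    (fun S U a y hS hU ha _ => hext S U a y hS hU ha) c t.isUniserial le_rfl s.g
  -- The object of the longer stage is kept, but its element is replaced by an extension of `s.g`,
  -- for compatibility.
  exact ⟨⟨t.V, t.b, z, t.mono, t.isUniserial, by rw [← hc, res_comp, hz, s.res_eq]⟩, ht, c, hc, hz⟩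

theorem exists_stage_sequence [Simple S] (hf : f ≠ 0)
    (hX : ∀ (S : C) (f : X.obj.obj (op S)), Simple S → f ≠ 0 → ∀ s : Stage X f,
      ∃ t : Stage X f, len s.V < len t.V) :
    ∃ s : ℕ → Stage X f, (∀ n, n ≤ len (s n).V) ∧ ∀ m n, m ≤ n →
      ∃ c : (s m).V ⟶ (s n).V, (s m).b ≫ c = (s n).b ∧ res X.obj c (s n).g = (s m).g := by
  choose next hlt hnext using fun s : Stage X f => s.exists_next hL hI
    (exists_extension_of_stages hL hI hX) (hX S f inferInstance hf s)
  let s : ℕ → Stage X f := fun n => n.rec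
    (Stage.base (hI S (indecomposable_of_simple S)) f) (fun _ t => next t)
  refine ⟨s, fun n => ?_, fun m n hmn => ?_⟩
  · induction n with
    | zero => exact Nat.zero_le _
    | succ n ih => exact ih.trans_lt (hlt (s n))
  · induction n, hmn using Nat.le_induction with
    | base => exact ⟨𝟙 _, Category.comp_id _, res_id _ _⟩
    | succ n _ ih =>
      obtain ⟨c, hc, hc'⟩ := ih
      obtain ⟨d, hd, hd'⟩ := hnext (s n)
      exact ⟨c ≫ d, by rw [reassoc_of% hc]; exact hd,
        by rw [res_comp, ← hc']; exact congrArg _ hd'⟩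

theorem exists_injective_summand {S : C} [Simple S] {f : X.obj.obj (op S)} (hf : f ≠ 0)
    (hX : ∀ (S : C) (f : X.obj.obj (op S)), Simple S → f ≠ 0 → ∀ s : Stage X f,
      ∃ t : Stage X f, len s.V < len t.V) :
    ∃ Y : LexCat C, IsDirectSummand Y X ∧ Indecomposable Y ∧ Injective Y := by
  obtain ⟨s, hlen, hs⟩ := exists_stage_sequence hL hI hf hX
  -- The union of the images of the `Hom(-, Vₙ)`; compatibility closes it under sums.
  let K : ∀ B : C, AddSubgroup (X.obj.obj (op B)) := fun B =>
    { carrier := {x | ∃ (n : ℕ) (h : B ⟶ (s n).V), res X.obj h (s n).g = x}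
      zero_mem' := ⟨0, 0, res_zero _ _⟩
      add_mem' := by
        rintro _ _ ⟨m, h, rfl⟩ ⟨n, k, rfl⟩
        obtain ⟨c, -, hc⟩ := hs m (max m n) (le_max_left _ _)
        obtain ⟨d, -, hd⟩ := hs n (max m n) (le_max_right _ _)
        exact ⟨max m n, h ≫ c + k ≫ d, by rw [res_add, res_comp, hc, res_comp, hd]⟩
      neg_mem' := by
        rintro _ ⟨m, h, rfl⟩
        exact ⟨m, -h, map_neg (resHom X.obj (s m).g B) h⟩ }
  have hK : ∀ {A B : C} (h : A ⟶ B) (x), x ∈ K B → res X.obj h x ∈ K A := by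
    rintro A B h _ ⟨n, k, rfl⟩
    exact ⟨n, h ≫ k, res_comp _ _ _ _⟩
  have hK' : ∀ {A B : C} (e : A ⟶ B) [Epi e] (x), res X.obj e x ∈ K A → x ∈ K B := by
    rintro A B e _ x ⟨n, h, hx⟩
    have h0 : kernel.ι e ≫ h = 0 := by
      apply (s n).eq_zero_of_res_eq_zero hf
      rw [res_comp, hx, ← res_comp, kernel.condition, res_zero]
    refine ⟨n, Abelian.epiDesc e h h0, res_injective X.obj e ?_⟩
    rw [← res_comp, Abelian.comp_epiDesc, hx]
  let Y : LexCat C := ⟨subFunctor X K hK, subFunctor_preservesFiniteLimits X K hK hK'⟩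
  let ι : Y ⟶ X := ObjectProperty.homMk (homOfRes (subFunctor X K hK) X.obj
    (fun B => (K B).subtype) fun h x => rfl)
  have hι : ∀ (B : C) (y : Y.obj.obj (op B)), lexApp ι y = 0 → y = 0 := fun B y hy => Subtype.ext hy
  have hmono : Mono ι := lex_mono_of_injective ι hι
  have hinj : Injective Y := by
    refine injective_of_extension hL hI Y fun S' U a y hS' hU ha => ?_
    obtain ⟨_, n, h, rfl⟩ := y
    by_cases h0 : h = 0
    · refine ⟨0, Subtype.ext ?_⟩
      subst h0
      exact (map_zero _).trans (res_zero X.obj _).symm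
    -- Since `n ≤ len (s n).V`, the index `max n (len U)` gives a stage long enough to receive `U`.
    obtain ⟨c, hc, hc'⟩ := hs n (max n (len U)) (le_max_left _ _)
    have := (s n).mono_of_comp_eq _ c hc
    have := mono_of_nonzero_from_simple h0
    obtain ⟨k, hk⟩ := exists_extension_of_len_le hL hI hU (s (max n (len U))).isUniserial a (h ≫ c)
      ((le_max_right _ _).trans (hlen _))
    refine ⟨⟨res X.obj k (s (max n (len U))).g, _, k, rfl⟩, Subtype.ext ?_⟩
    change res X.obj a (res X.obj k _) = res X.obj h (s n).g
    rw [← res_comp, hk, res_comp, hc']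
  refine ⟨Y, isDirectSummand_of_retract ι (Injective.factorThru (𝟙 Y) ι)
    (Injective.comp_factorThru _ _), ?_, hinj⟩
  have hfK : f ∈ K S := ⟨0, (s 0).b, (s 0).res_eq⟩
  refine indecomposable_of_essential (Y := Y) (S := S) ⟨f, hfK⟩
    (fun h0 => hf (congrArg Subtype.val h0)) fun B y hy => ?_
  obtain ⟨_, n, h, rfl⟩ := y
  have hh : h ≠ 0 := fun h0 => hy (Subtype.ext (by subst h0; exact res_zero _ _))
  have := (s n).mono
  obtain ⟨D, d, e, he, hde⟩ := (s n).isUniserial.exists_epi_of_ne_zero (s n).b h hh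
  refine ⟨D, d, e, he, Subtype.ext ?_⟩
  change res X.obj d (res X.obj h _) = res X.obj e f
  rw [← res_comp, hde, res_comp, (s n).res_eq]

theorem exists_representable_summand {S : C} [Simple S] {f : X.obj.obj (op S)} (hf : f ≠ 0)
    (s : Stage X f) (hs : ∀ t : Stage X f, len t.V ≤ len s.V) :
    IsDirectSummand ((lexYoneda C).obj s.V) X ∧ Indecomposable ((lexYoneda C).obj s.V) := by
  have hb := s.mono
  obtain ⟨φ, hφ⟩ := exists_retraction_of_maximal hL hI X.obj s.isUniserial s.b s.g
    (by rwa [s.res_eq]) fun U a w hU ha hlt h =>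
      (hs ⟨U, a, w, ha, hU, h.trans s.res_eq⟩).not_gt hlt
  refine ⟨isDirectSummand_of_retract (elemHom X s.g) (ObjectProperty.homMk φ)
    (lex_hom_ext fun B (h : B ⟶ s.V) => ?_), ?_⟩
  · refine (app_res φ h s.g).trans ?_
    rw [hφ]
    exact Category.comp_id h
  · refine indecomposable_of_essential (S := S) (show S ⟶ s.V from s.b)
      (fun h0 => Simple.not_isZero S (IsZero.of_mono_eq_zero s.b h0)) fun B (h : B ⟶ s.V) hh => ?_
    exact s.isUniserial.exists_epi_of_ne_zero s.b h hh

end Chain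

end Uniserial

theorem mainTheorem7 {C : Type u} [Category.{v} C] [Abelian C]
    (hC : Uniserial.IsUniserialCategory C)
    (X : Uniserial.LexCat C) (hX : ¬ IsZero X) :
    ∃ Y : Uniserial.LexCat C, Uniserial.IsDirectSummand Y X ∧ Indecomposable Y ∧
      ((Uniserial.lexYoneda C).essImage Y ∨ Injective Y) := by
  have hL := hC.exists_compSeries
  have hI : ∀ X : C, Indecomposable X → Uniserial.IsUniserial X := fun X hX =>
    Uniserial.isUniserial_of_unique_compSeries (hC.unique_compSeries X hX)
  by_cases h : ∀ (S : C) (f : X.obj.obj (op S)), Simple S → f ≠ 0 → ∀ s : Uniserial.Stage X f,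
      ∃ t : Uniserial.Stage X f, Uniserial.len s.V < Uniserial.len t.V
  · obtain ⟨B, x, hx⟩ := Uniserial.exists_ne_zero_of_not_isZero hX
    -- An element with zero annihilator restricts to a nonzero element on any simple subobject of
    -- `D`.
    obtain ⟨D, q, z, rfl, hz⟩ := Uniserial.exists_injective_element hL X.obj B x
    obtain ⟨S, s, hS, hs⟩ := Uniserial.exists_simple_mono hL D fun h0 => hx (by
      rw [h0.eq_zero_of_tgt q, Uniserial.res_zero])
    obtain ⟨Y, h1, h2, h3⟩ := Uniserial.exists_injective_summand hL hI
      (fun h0 => Simple.not_isZero S (IsZero.of_mono_eq_zero s (hz S s h0))) h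
    exact ⟨Y, h1, h2, .inr h3⟩
  · push Not at h
    obtain ⟨S, f, hS, hf, s, hs⟩ := h
    obtain ⟨h1, h2⟩ := Uniserial.exists_representable_summand hL hI hf s hs
    exact ⟨_, h1, h2, .inl ((Uniserial.lexYoneda C).obj_mem_essImage s.V)⟩
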